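/- Let $\mathbb G\cong\mathbb R^{d_1}\oplus\mathbb R^{d_2}$ be a step-$2$ Carnot group in exponential coordinates: $w_{ij}=-w_{ji}\in\mathbb R^{d_2}$ ($1\le i,j\le d_1$) are its structure constants, they span $\mathbb R^{d_2}$, $d_2\ge 1$, and with $[x,y]=\sum_{i,j}w_{ij}x_iy_j$ for $x,y\in\mathbb R^{d_1}$ the group law is $$(x^{(1)},x^{(2)})(y^{(1)},y^{(2)})=\bigl(x^{(1)}+y^{(1)},\,x^{(2)}+y^{(2)}+\tfrac12[x^{(1)},y^{(1)}]\bigr).$$ Let $V_i(x)=(e_i,\tfrac12[x^{(1)},e_i])$, $i\le d_1$, be the left-invariant horizontal vector fields, declared orthonormal, and let $d_{cc}$ be the associated Carnot–Carathéodory distance. Let $\Omega_{\mathbb G}=C_0([0,1],\mathbb G)$ be the space of continuous $\mathbb G$-valued paths started from the origin, with the uniform topology, and let $\mu$ be the law on $\Omega_{\mathbb G}$ of the Brownian motion $\mathbf B$ on $\mathbb G$, i.e. of the solution of $d\mathbf B_t=\sum_{i=1}^{d_1}V_i(\mathbf B_t)\,dB^i_t$, $\mathbf B_0=0$, where $B$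 is a standard $d_1$-dimensional Brownian motion. Let $\mathcal H=W^{1,2}_0([0,1],\mathbb R^{d_1})$ with $\|h\|_{\mathcal H}^2=\int_0^1|\dot h_t|^2\,dt$. For an absolutely continuous path $x$ in $\mathbb R^{d_1}$ with $x_0=0$ let $\Psi(x)_t=\bigl(x_t,\tfrac12\int_0^t[x_s,\dot x_s]\,ds\bigr)$. For $h\in\mathcal H$ and $\omega\in\Omega_{\mathbb G}$ let $T_h\omega=\lim_n\Psi(x^n+h)$, where $(x^n)$ is any sequence of such paths with $\Psi(x^n)\to\omega$ uniformly; the limit is uniform and does not depend on the sequence. Put $C_{\mathcal H}(\omega,\tilde\omega)=\|h\|_{\mathcal H}$ if $\tilde\omega=T_h\omega$ for some $h\in\mathcal H$, and $C_{\mathcal H}(\omega,\tilde\omega)=\infty$ otherwise. Let $L\colon\Omega_{\mathbb G}\to[0,\infty]$ be measurable, and suppose that there is a set $\tilde\Omega_{\mathbb G}\subseteq\Omega_{\mathbb G}$ of full $\mu$-measure such that $$d_{cc}(\omega_1,\tilde\omega_1)\le L(\omega)\,C_{\mathcal H}(\omega,\tilde\omega)\qquad\text{for all }\omega,\tilde\omega\in\tilde\Omega_{\mathbb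 G}\tag{$*$}$$ (with $0\cdot\infty=0$). Then $\mu(L=\infty)>0$. In particular, $\|L\|_{L^q(\mu)}=\infty$, i.e. $L\notin L^q(\mu)$, for every $q\in(0,\infty]$. Consequently, for no $p\in[1,2]$ does there exist a measurable $L$ satisfying $(*)$ for some set of full $\mu$-measure and such that $L\in L^{q}(\mu)$ with $q=\frac{2p}{2-p}$ ($q=\infty$ if $p=2$). The existence of such an $L$ is the hypothesis under which the contraction principle deduces a $T_p$ inequality for the heat kernel measure $\mu_1$ (the law of $\mathbf B_1$), with cost $d_{cc}$, from the $T_2$ inequality for $\mu$ with cost $C_{\mathcal H}$. -/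

import Mathlib

open MeasureTheory ProbabilityTheory Set Filter Topology
open scoped ENNReal unitInterval

/-- A step-`2` Carnot group in exponential coordinates on `ℝ^{d₁} ⊕ ℝ^{d₂}`, given by its structure
constants `w i j = [V_i, V_j] ∈ ℝ^{d₂}`, `i, j ≤ d₁`. The bracket is antisymmetric, the second layer
is nonzero (the group has step exactly two) and is spanned by the brackets of the first layer.
The Jacobi identity is automatic, as the second layer is central. -/
structure StepTwoCarnot (d₁ d₂ : ℕ) where
  w : Fin d₁ → Fin d₁ → EuclideanSpace ℝ (Fin d₂)
  antisymm : ∀ i j, w i j = -w j i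
  second_layer_pos : 0 < d₂
  span_eq_top : Submodule.span ℝ (Set.range fun p : Fin d₁ × Fin d₁ => w p.1 p.2) = ⊤

/-- The underlying manifold `ℝ^{d₁} ⊕ ℝ^{d₂}`, with its usual topology. -/
abbrev CarnotPoint (d₁ d₂ : ℕ) : Type :=
  EuclideanSpace ℝ (Fin d₁) × EuclideanSpace ℝ (Fin d₂)

/-- The space `C_0([0,1], 𝔾)` of continuous paths started from the origin. It carries the
compact-open topology, i.e. the topology of uniform convergence; since the Carnot–Carathéodory
distance induces the usual topology of `ℝ^{d₁} ⊕ ℝ^{d₂}`, this is the topology of the metric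
`sup_t d_cc(ω_t, ω'_t)`. -/
abbrev CarnotPath (d₁ d₂ : ℕ) : Type :=
  {ω : C(I, CarnotPoint d₁ d₂) // ω 0 = 0}

/-- The Borel σ-algebra of the path space. -/
instance CarnotPath.instMeasurableSpace (d₁ d₂ : ℕ) : MeasurableSpace (CarnotPath d₁ d₂) :=
  borel _

instance CarnotPath.instBorelSpace (d₁ d₂ : ℕ) : BorelSpace (CarnotPath d₁ d₂) := ⟨rfl⟩

namespace StepTwoCarnot

variable {d₁ d₂ : ℕ} (G : StepTwoCarnot d₁ d₂)

/-- The Lie bracket of first-layer vectors, `∑_{i,j} x_i y_j w_{ij}`. -/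
noncomputable def bracket (x y : EuclideanSpace ℝ (Fin d₁)) : EuclideanSpace ℝ (Fin d₂) :=
  ∑ i, ∑ j, (x i * y j) • G.w i j

theorem bracket_add_left (x x' y : EuclideanSpace ℝ (Fin d₁)) :
    G.bracket (x + x') y = G.bracket x y + G.bracket x' y := by
  simp [bracket, add_mul, add_smul, Finset.sum_add_distrib]

theorem bracket_add_right (x y y' : EuclideanSpace ℝ (Fin d₁)) :
    G.bracket x (y + y') = G.bracket x y + G.bracket x y' := by
  simp [bracket, mul_add, add_smul, Finset.sum_add_distrib]

theorem bracket_smul_right (c : ℝ) (x y : EuclideanSpace ℝ (Fin d₁)) :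
    G.bracket x (c • y) = c • G.bracket x y := by
  simp [bracket, Finset.smul_sum, smul_smul, mul_left_comm]

theorem bracket_swap (x y : EuclideanSpace ℝ (Fin d₁)) :
    G.bracket x y = -G.bracket y x := by
  unfold bracket
  rw [Finset.sum_comm, ← Finset.sum_neg_distrib]
  refine Finset.sum_congr rfl fun j _ => ?_
  rw [← Finset.sum_neg_distrib]
  refine Finset.sum_congr rfl fun i _ => ?_
  rw [G.antisymm i j, smul_neg, mul_comm]

theorem bracket_self (x : EuclideanSpace ℝ (Fin d₁)) : G.bracket x x = 0 := by
  have h := G.bracket_swap x x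
  ext k
  have hk := congrArg (fun z : EuclideanSpace ℝ (Fin d₂) => z k) h
  simp only [PiLp.neg_apply] at hk
  simp only [PiLp.zero_apply]
  linarith

theorem bracket_neg_left (x y : EuclideanSpace ℝ (Fin d₁)) :
    G.bracket (-x) y = -G.bracket x y := by
  simp [bracket]

/-- The group law `x y = x + y + ½ [x, y]` in Baker–Campbell–Hausdorff form. -/
noncomputable def mul (x y : CarnotPoint d₁ d₂) : CarnotPoint d₁ d₂ :=
  (x.1 + y.1, x.2 + y.2 + (1 / 2 : ℝ) • G.bracket x.1 y.1)

/-- The group structure on `ℝ^{d₁} ⊕ ℝ^{d₂}`; its unit is the origin. -/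
@[reducible] noncomputable def group : Group (CarnotPoint d₁ d₂) where
  mul := G.mul
  one := 0
  inv x := -x
  mul_assoc x y z := by
    change G.mul (G.mul x y) z = G.mul x (G.mul y z)
    ext1
    · simp [mul, add_assoc]
    · simp only [mul, bracket_add_left, bracket_add_right, smul_add]
      abel
  one_mul x := by
    change G.mul 0 x = x
    ext1 <;> simp [mul, bracket]
  mul_one x := by
    change G.mul x 0 = x
    ext1 <;> simp [mul, bracket]
  inv_mul_cancel x := by
    change G.mul (-x) x = 0
    ext1 <;> simp [mul, bracket_neg_left, bracket_self]

/-- The horizontal tangent vector `∑_i v_i V_i(x)` at `x`, where `V_i(x) = (e_i, ½ [x, e_i])`,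
`i ≤ d₁`, are the left-invariant vector fields spanning the first layer. -/
noncomputable def horizontal (x : CarnotPoint d₁ d₂) :
    EuclideanSpace ℝ (Fin d₁) →ₗ[ℝ] CarnotPoint d₁ d₂ where
  toFun v := (v, (1 / 2 : ℝ) • G.bracket x.1 v)
  map_add' v v' := by simp [bracket_add_right]
  map_smul' c v := by simp [bracket_smul_right, smul_comm c]

/-- `∑_i v_i V_i(x)` is the image of `(v, 0)` under the differential at the origin of the left
translation by `x`. -/
theorem hasDerivAt_mul (x : CarnotPoint d₁ d₂) (v : EuclideanSpace ℝ (Fin d₁)) :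
    HasDerivAt (fun s : ℝ => G.mul x (s • v, 0)) (G.horizontal x v) 0 := by
  have h : (fun s : ℝ => G.mul x (s • v, 0)) = fun s : ℝ => x + s • G.horizontal x v := by
    funext s
    ext1
    · simp [mul, horizontal]
    · simp [mul, horizontal, bracket_smul_right, smul_comm s]
  rw [h]
  simpa using ((hasDerivAt_id (0 : ℝ)).smul_const (G.horizontal x v)).const_add x

/-- A horizontal curve: absolutely continuous on `[0,1]`, with velocity in the horizontal bundle
at almost every time. -/
def IsHorizontalCurve (γ : ℝ → CarnotPoint d₁ d₂) : Prop :=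
  AbsolutelyContinuousOnInterval γ 0 1 ∧
    ∀ᵐ t ∂(volume.restrict (Icc (0 : ℝ) 1)), ∃ v, deriv γ t = G.horizontal (γ t) v

/-- The Carnot–Carathéodory distance, as the infimum of the lengths of horizontal curves. The
`V_i` are orthonormal, so the horizontal vector `∑_i v_i V_i(x)`, whose first component is `v`, has
length `|v|`. -/
noncomputable def dcc (x y : CarnotPoint d₁ d₂) : ℝ≥0∞ :=
  ⨅ (γ : ℝ → CarnotPoint d₁ d₂) (_ : G.IsHorizontalCurve γ ∧ γ 0 = x ∧ γ 1 = y),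
    ∫⁻ t in Icc (0 : ℝ) 1, ‖(deriv γ t).1‖ₑ

end StepTwoCarnot

/-- `h ∈ AC_0([0,1], ℝ^d)`; only the values of `h` on `[0,1]` matter. -/
def IsACZero {d : ℕ} (h : ℝ → EuclideanSpace ℝ (Fin d)) : Prop :=
  AbsolutelyContinuousOnInterval h 0 1 ∧ h 0 = 0

/-- Membership in the Cameron–Martin space `W^{1,2}_0([0,1], ℝ^d)`. -/
def IsCameronMartin {d : ℕ} (h : ℝ → EuclideanSpace ℝ (Fin d)) : Prop :=
  IsACZero h ∧ MemLp (deriv h) 2 (volume.restrict (Icc (0 : ℝ) 1))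

/-- The Cameron–Martin norm `(∫_0^1 |h'_t|² dt)^{1/2}`. -/
noncomputable def cameronMartinNorm {d : ℕ} (h : ℝ → EuclideanSpace ℝ (Fin d)) : ℝ≥0∞ :=
  eLpNorm (deriv h) 2 (volume.restrict (Icc (0 : ℝ) 1))

namespace StepTwoCarnot

variable {d₁ d₂ : ℕ} (G : StepTwoCarnot d₁ d₂)

/-- The canonical lift of an absolutely continuous path `h`: the horizontal path
`t ↦ (h_t, ½ ∫_0^t [h_s, h'_s] ds)`. -/
noncomputable def lift (h : ℝ → EuclideanSpace ℝ (Fin d₁)) (t : I) : CarnotPoint d₁ d₂ :=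
  (h t, (1 / 2 : ℝ) • ∫ s in (0 : ℝ)..t, G.bracket (h s) (deriv h s))

/-- The relation `Y = T_h X`, where `T_h X = lim_n Ψ(xⁿ + h)` for approximations of `X` by canonical
lifts `Ψ(xⁿ)` of absolutely continuous paths `xⁿ` started from the origin: whenever `Ψ(xⁿ) → X`
uniformly, `Ψ(xⁿ + h) → Y` uniformly. Every continuous path `X` from the origin is such a uniform
limit, and for `h` in the Cameron–Martin space the limit exists and does not depend on the
approximation, so exactly one `Y` satisfies the relation. -/
def IsShift (h : ℝ → EuclideanSpace ℝ (Fin d₁)) (X Y : CarnotPath d₁ d₂) : Prop :=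
  ∀ x : ℕ → ℝ → EuclideanSpace ℝ (Fin d₁), (∀ n, IsACZero (x n)) →
    TendstoUniformly (fun n t => G.lift (x n) t) (fun t => X.1 t) atTop →
    TendstoUniformly (fun n t => G.lift (x n + h) t) (fun t => Y.1 t) atTop

/-- The cost `C_H(X, Y)`: the Cameron–Martin norm of `h` if `Y = T_h X` for some (necessarily unique
on `[0,1]`) Cameron–Martin path `h`, and `∞` otherwise. -/
noncomputable def costCM (X Y : CarnotPath d₁ d₂) : ℝ≥0∞ :=
  ⨅ (h : ℝ → EuclideanSpace ℝ (Fin d₁)) (_ : IsCameronMartin h ∧ G.IsShift h X Y),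
    cameronMartinNorm h

end StepTwoCarnot

/-- Standard `d`-dimensional Brownian motion on the time interval `[0,1]`. -/
structure IsBrownianMotion {d : ℕ} {Ω : Type*} [MeasurableSpace Ω]
    (B : I → Ω → EuclideanSpace ℝ (Fin d)) (P : Measure Ω) : Prop where
  zero : ∀ᵐ ω ∂P, B 0 ω = 0
  indep : HasIndepIncrements B P
  law : ∀ s t : I, s ≤ t →
    HasLaw (fun ω => B t ω - B s ω)
      ((stdGaussian (EuclideanSpace ℝ (Fin d))).map fun z => √((t : ℝ) - s) • z) P
  continuous : ∀ᵐ ω ∂P, Continuous fun t => B t ω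

/-- `J_t = ∫_0^t H_s dB_s` for all `t ∈ [0,1]`, as an Itô integral of an adapted continuous
operator-valued integrand `H`: the left-endpoint sums `∑_k H_{τ_k} (B_{τ_{k+1}} - B_{τ_k})` converge
to `J_t` in probability along every sequence of partitions of `[0,t]` with mesh tending to `0`. -/
def IsItoIntegral {E F Ω : Type*} [AddCommGroup E] [Module ℝ E] [AddCommGroup F] [Module ℝ F]
    [EDist F] [MeasurableSpace Ω] (P : Measure Ω) (H : I → Ω → E →ₗ[ℝ] F) (B : I → Ω → E)
    (J : I → Ω → F) : Prop :=
  ∀ (t : I) (N : ℕ → ℕ) (τ : ℕ → ℕ → I),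
    (∀ n, Monotone (τ n)) → (∀ n, τ n 0 = 0) → (∀ n, τ n (N n) = t) →
    (∀ ε : ℝ, 0 < ε → ∀ᶠ n in atTop, ∀ k < N n, (τ n (k + 1) : ℝ) - τ n k < ε) →
    TendstoInMeasure P
      (fun n ω => ∑ k ∈ Finset.range (N n),
        H (τ n k) ω (B (τ n (k + 1)) ω - B (τ n k) ω))
      atTop (J t)

/-- `X` is a Brownian motion on the Carnot group driven by the `d₁`-dimensional Brownian motion `B`:
it has continuous paths started from the origin and solves the stochastic differential equation
`dX_t = ∑_i V_i(X_t) dB^i_t`. -/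
structure IsCarnotBrownianMotion {d₁ d₂ : ℕ} (G : StepTwoCarnot d₁ d₂) {Ω : Type*}
    [MeasurableSpace Ω] (P : Measure Ω) (B : I → Ω → EuclideanSpace ℝ (Fin d₁))
    (X : Ω → CarnotPath d₁ d₂) : Prop where
  brownian : IsBrownianMotion B P
  sde : IsItoIntegral P (fun t ω => G.horizontal ((X ω).1 t)) B (fun t ω => (X ω).1 t)

/-- `L` is a contraction function for `ψ` with respect to the costs `c` and `c'` on a set of full
`η`-measure: it is measurable and `c' (ψ x) (ψ y) ≤ L x * c x y` for all `x, y` in that set. -/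
def IsContractionFunction {E S : Type*} [MeasurableSpace E] (η : Measure E) (c : E → E → ℝ≥0∞)
    (c' : S → S → ℝ≥0∞) (ψ : E → S) (L : E → ℝ≥0∞) : Prop :=
  Measurable L ∧ ∃ E₀ : Set E, (∀ᵐ x ∂η, x ∈ E₀) ∧
    ∀ x ∈ E₀, ∀ y ∈ E₀, c' (ψ x) (ψ y) ≤ L x * c x y

/-!
The contraction bound already fails along straight lines `h_t = t v`. Integrating by parts, the
translate `T_h ω` is given by an explicit formula for every continuous path `ω` (`shift`,
`isShift_line`), and the second component of `ω₁⁻¹ (T_h ω)₁` is `[∫₀¹ ω⁽¹⁾ ds - ω⁽¹⁾₁, v]`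
(`endpointArea`), which is *linear* in `v`. On the other hand the second component of `x⁻¹ y` is
at most of order `d_cc(x, y)²` (`norm_sub_le_of_dcc_lt`), because it is the area swept out by a
horizontal curve. Replacing `v` by `v / (n + 1)`, for which the cost is at most `‖v‖ / (n + 1)`, and
letting `n → ∞`, the bound with `L ω < ∞` forces `endpointArea v ω = 0`
(`endpointArea_eq_zero_of_dcc_le`).

The bound is only assumed on a set of full measure, so translates of typical paths must be typical:
this is the Cameron–Martin theorem for straight lines (`quasiMeasurePreserving_shift`). For a unit
vector `e` the driving Brownian motion `B` is the sum of `t ↦ t Z e`, with `Z = ⟨e, B₁⟩`, and of a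
bridge which is Gaussian and uncorrelated with `Z`, hence independent of it. Correspondingly
`X = T_{Z e} R`, where the path `R = T_{-Z e} X` is independent of `Z`: its first layer is the bridge,
and its second layer is a limit of discrete areas of the bridge, because `T` changes the discrete
areas in a convergent way (`tendsto_areaSum_shift_sub`). As translations compose additively, `T_{c e}`
only replaces `Z` by `Z + c`, and the laws of these two variables are equivalent.

Finally, if `L` were finite almost surely, `endpointArea v` would vanish almost surely, hence also
after translation by any `u`; but this translation changes it by `-½ [u, v]`, and the brackets do not
all vanish. So `L = ∞` with positive probability, and `L` lies in no `L^q`.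
-/

/-! ### Absolutely continuous curves in Euclidean space -/

namespace AbsolutelyContinuousOnInterval

variable {a b : ℝ}

theorem lipschitz_comp {Y Z : Type*} [PseudoMetricSpace Y] [PseudoMetricSpace Z] {K : NNReal}
    {g : Y → Z} (hg : LipschitzWith K g) {f : ℝ → Y} (hf : AbsolutelyContinuousOnInterval f a b) :
    AbsolutelyContinuousOnInterval (fun t => g (f t)) a b := by
  unfold AbsolutelyContinuousOnInterval at hf ⊢
  refine squeeze_zero (fun E => Finset.sum_nonneg fun i _ => dist_nonneg) (fun E => ?_)
    (by simpa using hf.const_mul (K : ℝ))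
  rw [Finset.mul_sum]
  exact Finset.sum_le_sum fun i _ => hg.dist_le_mul _ _

theorem clm_comp {Y Z : Type*} [NormedAddCommGroup Y] [NormedSpace ℝ Y] [NormedAddCommGroup Z]
    [NormedSpace ℝ Z] (l : Y →L[ℝ] Z) {f : ℝ → Y} (hf : AbsolutelyContinuousOnInterval f a b) :
    AbsolutelyContinuousOnInterval (fun t => l (f t)) a b :=
  hf.lipschitz_comp l.lipschitz

variable {d : ℕ} {f : ℝ → EuclideanSpace ℝ (Fin d)}

theorem coord (hf : AbsolutelyContinuousOnInterval f a b) (i : Fin d) :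
    AbsolutelyContinuousOnInterval (fun t => f t i) a b :=
  hf.clm_comp (EuclideanSpace.proj (𝕜 := ℝ) i)

theorem ae_deriv_coord (hf : AbsolutelyContinuousOnInterval f a b) :
    ∀ᵐ x, x ∈ uIcc a b → ∀ i, deriv (fun t => f t i) x = deriv f x i := by
  filter_upwards [hf.boundedVariationOn.ae_differentiableAt_of_mem_uIcc] with x hx hxm i
  exact ((EuclideanSpace.proj (𝕜 := ℝ) i).hasFDerivAt.comp_hasDerivAt x
    (hx hxm).hasDerivAt).deriv

theorem intervalIntegrable_deriv_euclidean (hf : AbsolutelyContinuousOnInterval f a b) :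
    IntervalIntegrable (deriv f) volume a b := by
  rw [intervalIntegrable_iff]
  have h : ∀ i, IntegrableOn (fun x => deriv f x i) (uIoc a b) := fun i => by
    have h1 := intervalIntegrable_iff.1 (hf.coord i).intervalIntegrable_deriv
    refine h1.congr ?_
    rw [EventuallyEq, ae_restrict_iff' measurableSet_uIoc]
    filter_upwards [hf.ae_deriv_coord] with x hx hxm
    exact hx (uIoc_subset_uIcc hxm) i
  have h2 : IntegrableOn (fun x => ∑ i, (deriv f x i) • (EuclideanSpace.basisFun (Fin d) ℝ i))
      (uIoc a b) := integrable_finsetSum _ fun i _ => (h i).smul_const _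
  refine h2.congr (Eventually.of_forall fun x => ?_)
  simpa using (EuclideanSpace.basisFun (Fin d) ℝ).sum_repr (deriv f x)

/-- The fundamental theorem of calculus for absolutely continuous curves in `ℝ^d`. -/
theorem integral_deriv_eq_sub_euclidean (hf : AbsolutelyContinuousOnInterval f a b) :
    ∫ x in a..b, deriv f x = f b - f a := by
  ext i
  have h := (EuclideanSpace.proj (𝕜 := ℝ) i).intervalIntegral_comp_comm
    hf.intervalIntegrable_deriv_euclidean
  have h2 := (hf.coord i).integral_deriv_eq_sub
  refine h.symm.trans ?_
  rw [PiLp.sub_apply, ← h2]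
  refine intervalIntegral.integral_congr_ae ?_
  filter_upwards [hf.ae_deriv_coord] with x hx hxm
  exact (hx (uIoc_subset_uIcc hxm) i).symm

end AbsolutelyContinuousOnInterval

/-! ### The bracket as a bilinear map -/

namespace StepTwoCarnot

variable {d₁ d₂ : ℕ} (G : StepTwoCarnot d₁ d₂)

theorem bracket_smul_left (c : ℝ) (x y : EuclideanSpace ℝ (Fin d₁)) :
    G.bracket (c • x) y = c • G.bracket x y := by
  rw [G.bracket_swap, G.bracket_smul_right, G.bracket_swap y x, smul_neg, neg_neg]

/-- The Lie bracket as a continuous bilinear map. -/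
noncomputable def bracketCLM : EuclideanSpace ℝ (Fin d₁) →L[ℝ] EuclideanSpace ℝ (Fin d₁) →L[ℝ]
    EuclideanSpace ℝ (Fin d₂) :=
  (LinearMap.mk₂ ℝ G.bracket G.bracket_add_left G.bracket_smul_left G.bracket_add_right
    G.bracket_smul_right).toContinuousBilinearMap

theorem bracketCLM_apply (x y : EuclideanSpace ℝ (Fin d₁)) : G.bracketCLM x y = G.bracket x y :=
  rfl

-- only bilinearity and continuity are used from here on, never the double sum
attribute [irreducible] bracketCLM

theorem bracket_basisFun (i j : Fin d₁) :
    G.bracket (EuclideanSpace.basisFun (Fin d₁) ℝ i) (EuclideanSpace.basisFun (Fin d₁) ℝ j)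
      = G.w i j := by
  simp [bracket]

/-- Two vectors of the standard basis do not commute, since the brackets of these vectors span a
nonzero space. -/
theorem exists_bracket_basisFun_ne_zero : ∃ i j, G.bracket (EuclideanSpace.basisFun (Fin d₁) ℝ i)
    (EuclideanSpace.basisFun (Fin d₁) ℝ j) ≠ 0 := by
  by_contra! h
  simp only [bracket_basisFun] at h
  have hspan := G.span_eq_top
  have hr : (Submodule.span ℝ (Set.range fun p : Fin d₁ × Fin d₁ => G.w p.1 p.2)) = ⊥ := by
    rw [Submodule.span_eq_bot]
    rintro _ ⟨p, rfl⟩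
    exact h _ _
  rw [hr] at hspan
  have hf := congrArg (fun S : Submodule ℝ (EuclideanSpace ℝ (Fin d₂)) => Module.finrank ℝ S) hspan
  simp only [finrank_bot, finrank_top, finrank_euclideanSpace, Fintype.card_fin] at hf
  exact G.second_layer_pos.ne hf

theorem intervalIntegrable_bracket_deriv {x f : ℝ → EuclideanSpace ℝ (Fin d₁)} {a b : ℝ}
    (hx : ContinuousOn x (uIcc a b)) (hf : AbsolutelyContinuousOnInterval f a b) :
    IntervalIntegrable (fun s => G.bracket (x s) (deriv f s)) volume a b := by
  simp only [← bracketCLM_apply]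
  obtain ⟨C, hC⟩ := isCompact_uIcc.exists_bound_of_continuousOn hx
  have hd := intervalIntegrable_iff.1 hf.intervalIntegrable_deriv_euclidean
  rw [intervalIntegrable_iff]
  refine G.bracketCLM.integrable_of_bilin_of_bdd_left C
    ((hx.mono uIoc_subset_uIcc).aestronglyMeasurable measurableSet_uIoc) ?_ hd
  rw [ae_restrict_iff' measurableSet_uIoc]
  exact Eventually.of_forall fun s hs => hC s (uIoc_subset_uIcc hs)

/-! ### A lower bound for the Carnot–Carathéodory distance -/

/-- Along a horizontal curve the second layer is controlled by the area swept out by the first, hence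
by the square of the length. -/
theorem IsHorizontalCurve.norm_sub_le {γ : ℝ → CarnotPoint d₁ d₂} (hγ : G.IsHorizontalCurve γ)
    {r : ℝ} (hr : 0 ≤ r)
    (hlen : ∫⁻ t in Icc (0 : ℝ) 1, ‖(deriv γ t).1‖ₑ ≤ ENNReal.ofReal r) :
    ‖(γ 1).2 - (γ 0).2 - (1 / 2 : ℝ) • G.bracket (γ 0).1 (γ 1).1‖ ≤ ‖G.bracketCLM‖ * r ^ 2 := by
  obtain ⟨hac, hhor⟩ := hγ
  rw [← bracketCLM_apply]
  have h1 : AbsolutelyContinuousOnInterval (fun t => (γ t).1) 0 1 :=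
    hac.lipschitz_comp LipschitzWith.prod_fst
  have h2 : AbsolutelyContinuousOnInterval (fun t => (γ t).2) 0 1 :=
    hac.lipschitz_comp LipschitzWith.prod_snd
  have hd1 : ∀ᵐ t, t ∈ Icc (0 : ℝ) 1 → deriv (fun t => (γ t).1) t = (deriv γ t).1 ∧
      deriv (fun t => (γ t).2) t = (1 / 2 : ℝ) • G.bracketCLM (γ t).1 (deriv γ t).1 := by
    rw [ae_restrict_iff' measurableSet_Icc] at hhor
    filter_upwards [h1.boundedVariationOn.ae_differentiableAt_of_mem_uIcc,
      h2.boundedVariationOn.ae_differentiableAt_of_mem_uIcc, hhor] with t ht1 ht2 hh htm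
    have htm' : t ∈ uIcc (0 : ℝ) 1 := by rwa [uIcc_of_le zero_le_one]
    have hdf : deriv γ t = (deriv (fun t => (γ t).1) t, deriv (fun t => (γ t).2) t) :=
      ((ht1 htm').hasDerivAt.prodMk (ht2 htm').hasDerivAt).deriv
    obtain ⟨v, hv⟩ := hh htm
    rw [hv] at hdf ⊢
    exact ⟨(congrArg Prod.fst hdf).symm, (congrArg Prod.snd hdf).symm.trans
      (by rw [bracketCLM_apply]; rfl)⟩
  set g : ℝ → EuclideanSpace ℝ (Fin d₁) := fun t => (γ t).1 with hg
  have hint : IntervalIntegrable (deriv g) volume 0 1 := h1.intervalIntegrable_deriv_euclidean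
  have hlen' : ∫ t in (0 : ℝ)..1, ‖deriv g t‖ ≤ r := by
    rw [intervalIntegral.integral_of_le zero_le_one,
      integral_norm_eq_lintegral_enorm
        ((intervalIntegrable_iff_integrableOn_Ioc_of_le zero_le_one).1 hint).aestronglyMeasurable]
    refine ENNReal.toReal_le_of_le_ofReal hr (le_trans (le_of_eq ?_) hlen)
    rw [restrict_Ioc_eq_restrict_Icc]
    refine lintegral_congr_ae ?_
    rw [EventuallyEq, ae_restrict_iff' measurableSet_Icc]
    filter_upwards [hd1] with t ht htm
    rw [(ht htm).1]
  -- the first layer stays within distance `r` of its starting point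
  have hdist : ∀ t ∈ Icc (0 : ℝ) 1, ‖g t - g 0‖ ≤ r := fun t ht => by
    have hsub : uIcc 0 t ⊆ uIcc (0 : ℝ) 1 := by
      rw [uIcc_of_le ht.1, uIcc_of_le zero_le_one]
      exact Icc_subset_Icc_right ht.2
    rw [← (h1.mono hsub).integral_deriv_eq_sub_euclidean]
    refine (intervalIntegral.norm_integral_le_integral_norm ht.1).trans (le_trans ?_ hlen')
    exact intervalIntegral.integral_mono_interval le_rfl ht.1 ht.2
      (Eventually.of_forall fun _ => norm_nonneg _) hint.norm
  have hgc : ContinuousOn g (uIcc 0 1) := h1.continuousOn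
  have hI1 := G.intervalIntegrable_bracket_deriv hgc h1
  simp only [← bracketCLM_apply] at hI1
  have hI2 := G.intervalIntegrable_bracket_deriv (x := fun _ => g 0) continuousOn_const h1
  simp only [← bracketCLM_apply] at hI2
  have key : (γ 1).2 - (γ 0).2 - (1 / 2 : ℝ) • G.bracketCLM (γ 0).1 (γ 1).1
      = (1 / 2 : ℝ) • ∫ t in (0 : ℝ)..1, G.bracketCLM (g t - g 0) (deriv g t) := by
    have e1 : (γ 1).2 - (γ 0).2 = (1 / 2 : ℝ) • ∫ t in (0 : ℝ)..1, G.bracketCLM (g t) (deriv g t) := by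
      rw [← h2.integral_deriv_eq_sub_euclidean, ← intervalIntegral.integral_smul]
      refine intervalIntegral.integral_congr_ae ?_
      filter_upwards [hd1] with t ht htm
      have htm' : t ∈ Icc (0 : ℝ) 1 := by
        rw [uIoc_of_le zero_le_one] at htm
        exact Ioc_subset_Icc_self htm
      rw [(ht htm').2, (ht htm').1]
    have e2 : G.bracketCLM (γ 0).1 (γ 1).1 = ∫ t in (0 : ℝ)..1, G.bracketCLM (g 0) (deriv g t) := by
      have := (G.bracketCLM (g 0)).intervalIntegral_comp_comm hint
      rw [this, h1.integral_deriv_eq_sub_euclidean, map_sub, G.bracketCLM_apply (g 0) (g 0),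
        bracket_self, sub_zero]
    rw [e1, e2, ← smul_sub, ← intervalIntegral.integral_sub hI1 hI2]
    congr 2 with t : 1
    rw [map_sub]
    rfl
  rw [key, norm_smul]
  have hb : ‖∫ t in (0 : ℝ)..1, G.bracketCLM (g t - g 0) (deriv g t)‖ ≤
      ∫ t in (0 : ℝ)..1, ‖G.bracketCLM‖ * r * ‖deriv g t‖ := by
    refine intervalIntegral.norm_integral_le_of_norm_le zero_le_one ?_ (hint.norm.const_mul _)
    refine Eventually.of_forall fun t ht => (G.bracketCLM.le_opNorm₂ _ _).trans ?_
    gcongr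
    exact hdist t (Ioc_subset_Icc_self ht)
  rw [intervalIntegral.integral_const_mul] at hb
  have hb2 : ‖G.bracketCLM‖ * r * ∫ t in (0 : ℝ)..1, ‖deriv g t‖ ≤ ‖G.bracketCLM‖ * r * r := by
    gcongr
  rw [Real.norm_of_nonneg (by norm_num : (0 : ℝ) ≤ 1 / 2)]
  have hpos : 0 ≤ ‖G.bracketCLM‖ * r * r := by positivity
  calc _ ≤ 1 / 2 * (‖G.bracketCLM‖ * r * r) := by gcongr; exact hb.trans hb2
    _ ≤ ‖G.bracketCLM‖ * r ^ 2 := by linarith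

/-- The second component of `x⁻¹ y` is at most of the order of `d_cc(x, y)²`. -/
theorem norm_sub_le_of_dcc_lt {x y : CarnotPoint d₁ d₂} {r : ℝ} (hr : 0 ≤ r)
    (h : G.dcc x y < ENNReal.ofReal r) :
    ‖y.2 - x.2 - (1 / 2 : ℝ) • G.bracket x.1 y.1‖ ≤ ‖G.bracketCLM‖ * r ^ 2 := by
  simp only [dcc, iInf_lt_iff] at h
  obtain ⟨γ, ⟨hγ, rfl, rfl⟩, hlt⟩ := h
  exact hγ.norm_sub_le G hr hlt.le

end StepTwoCarnot

/-! ### Translations of paths along straight lines -/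

/-- The first layer of a path of the Carnot group, extended to `ℝ` by its values at `0` and `1`. -/
noncomputable def CarnotPath.base {d₁ d₂ : ℕ} (ω : CarnotPath d₁ d₂) (s : ℝ) :
    EuclideanSpace ℝ (Fin d₁) :=
  (ω.1 (projIcc 0 1 zero_le_one s)).1

theorem CarnotPath.base_coe {d₁ d₂ : ℕ} (ω : CarnotPath d₁ d₂) (t : I) :
    ω.base t = (ω.1 t).1 := by
  rw [CarnotPath.base, projIcc_val]

theorem CarnotPath.base_of_mem {d₁ d₂ : ℕ} (ω : CarnotPath d₁ d₂) {s : ℝ} (hs : s ∈ Icc (0 : ℝ) 1) :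
    ω.base s = (ω.1 ⟨s, hs⟩).1 := by
  rw [CarnotPath.base, projIcc_of_mem]

theorem CarnotPath.continuous_uncurry_base {d₁ d₂ : ℕ} :
    Continuous fun p : CarnotPath d₁ d₂ × ℝ => p.1.base p.2 := by
  unfold CarnotPath.base
  exact continuous_fst.comp ((continuous_subtype_val.comp continuous_fst).eval
    (continuous_projIcc.comp continuous_snd))

theorem CarnotPath.continuous_base {d₁ d₂ : ℕ} (ω : CarnotPath d₁ d₂) : Continuous ω.base :=
  CarnotPath.continuous_uncurry_base.comp (Continuous.prodMk_right ω)

namespace StepTwoCarnot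

variable {d₁ d₂ : ℕ} (G : StepTwoCarnot d₁ d₂)

/-- The value at time `t` of the translate of `ω` along the straight line `s ↦ s v`. The formula makes
sense for every continuous path, as the Stieltjes integrals in the second layer are integrated by
parts. -/
noncomputable def shiftPoint (v : EuclideanSpace ℝ (Fin d₁)) (ω : CarnotPath d₁ d₂) (t : I) :
    CarnotPoint d₁ d₂ :=
  ((ω.1 t).1 + (t : ℝ) • v, (ω.1 t).2 + G.bracketCLM (∫ s in (0 : ℝ)..t, ω.base s) v
    - ((t : ℝ) / 2) • G.bracketCLM (ω.1 t).1 v)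

theorem continuous_uncurry_shiftPoint :
    Continuous fun p : (EuclideanSpace ℝ (Fin d₁) × CarnotPath d₁ d₂) × I =>
      G.shiftPoint p.1.1 p.1.2 p.2 := by
  have he : Continuous fun p : (EuclideanSpace ℝ (Fin d₁) × CarnotPath d₁ d₂) × I =>
      p.1.2.1 p.2 := by fun_prop
  have hi : Continuous fun p : (EuclideanSpace ℝ (Fin d₁) × CarnotPath d₁ d₂) × I =>
      ∫ s in (0 : ℝ)..p.2, p.1.2.base s := by
    refine intervalIntegral.continuous_parametric_intervalIntegral_of_continuous
      (f := fun (p : (EuclideanSpace ℝ (Fin d₁) × CarnotPath d₁ d₂) × I) s => p.1.2.base s) ?_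
      (by fun_prop)
    exact CarnotPath.continuous_uncurry_base.comp (by fun_prop : Continuous
      fun q : ((EuclideanSpace ℝ (Fin d₁) × CarnotPath d₁ d₂) × I) × ℝ => (q.1.1.2, q.2))
  have hv : Continuous fun p : (EuclideanSpace ℝ (Fin d₁) × CarnotPath d₁ d₂) × I => p.1.1 := by
    fun_prop
  have ht : Continuous fun p : (EuclideanSpace ℝ (Fin d₁) × CarnotPath d₁ d₂) × I => (p.2 : ℝ) := by
    fun_prop
  refine ((continuous_fst.comp he).add (ht.smul hv)).prodMk
    (((continuous_snd.comp he).add (G.bracketCLM.continuous₂.comp (hi.prodMk hv))).sub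
      ((ht.div_const 2).smul (G.bracketCLM.continuous₂.comp ((continuous_fst.comp he).prodMk hv))))

/-- The translate `T_h ω` of a path `ω` along the straight line `h_t = t v`. -/
noncomputable def shift (v : EuclideanSpace ℝ (Fin d₁)) (ω : CarnotPath d₁ d₂) :
    CarnotPath d₁ d₂ :=
  ⟨⟨G.shiftPoint v ω, G.continuous_uncurry_shiftPoint.comp (Continuous.prodMk_right (v, ω))⟩, by
    change G.shiftPoint v ω 0 = 0
    simp [shiftPoint, ω.2]⟩

theorem shift_apply (v : EuclideanSpace ℝ (Fin d₁)) (ω : CarnotPath d₁ d₂) (t : I) :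
    (G.shift v ω).1 t = G.shiftPoint v ω t := rfl

theorem continuous_uncurry_shift :
    Continuous fun p : EuclideanSpace ℝ (Fin d₁) × CarnotPath d₁ d₂ => G.shift p.1 p.2 :=
  Continuous.subtype_mk (ContinuousMap.continuous_of_continuous_uncurry _
    G.continuous_uncurry_shiftPoint) _

theorem continuous_shift (v : EuclideanSpace ℝ (Fin d₁)) : Continuous (G.shift v) :=
  G.continuous_uncurry_shift.comp (Continuous.prodMk_right v)

theorem integral_base_shift (v : EuclideanSpace ℝ (Fin d₁)) (ω : CarnotPath d₁ d₂) (t : I) :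
    ∫ s in (0 : ℝ)..t, (G.shift v ω).base s
      = (∫ s in (0 : ℝ)..t, ω.base s) + ((t : ℝ) ^ 2 / 2) • v := by
  have h : ∀ s ∈ uIcc (0 : ℝ) t, (G.shift v ω).base s = ω.base s + s • v := fun s hs => by
    rw [uIcc_of_le t.2.1] at hs
    have hs' : s ∈ Icc (0 : ℝ) 1 := ⟨hs.1, hs.2.trans t.2.2⟩
    rw [CarnotPath.base_of_mem _ hs', CarnotPath.base_of_mem _ hs']
    rfl
  rw [intervalIntegral.integral_congr h, intervalIntegral.integral_add
    (ω.continuous_base.intervalIntegrable _ _)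
    ((by fun_prop : Continuous fun s : ℝ => s • v).intervalIntegrable _ _),
    intervalIntegral.integral_smul_const, integral_id]
  simp

theorem bracketCLM_self (x : EuclideanSpace ℝ (Fin d₁)) : G.bracketCLM x x = 0 := by
  rw [bracketCLM_apply, bracket_self]

theorem bracketCLM_swap (x y : EuclideanSpace ℝ (Fin d₁)) :
    G.bracketCLM x y = -G.bracketCLM y x := by
  rw [bracketCLM_apply, bracketCLM_apply, bracket_swap]

theorem shift_zero (ω : CarnotPath d₁ d₂) : G.shift 0 ω = ω := by
  refine Subtype.ext (ContinuousMap.ext fun t => ?_)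
  simp [shift_apply, shiftPoint]

/-- Translations along straight lines compose additively. -/
theorem shift_shift (v u : EuclideanSpace ℝ (Fin d₁)) (ω : CarnotPath d₁ d₂) :
    G.shift v (G.shift u ω) = G.shift (v + u) ω := by
  refine Subtype.ext (ContinuousMap.ext fun t => ?_)
  rw [shift_apply, shift_apply, shiftPoint, shiftPoint, integral_base_shift, shift_apply, shiftPoint]
  refine Prod.ext ?_ ?_
  · simp only [smul_add]
    abel
  · simp only [map_add, map_smul, add_apply, smul_apply]
    module

/-- The second component of `ω₁⁻¹ (T_h ω)₁` for `h_t = t v`. It is linear in `v`, whereas the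
Carnot–Carathéodory norm only controls it quadratically. -/
noncomputable def endpointArea (v : EuclideanSpace ℝ (Fin d₁)) (ω : CarnotPath d₁ d₂) :
    EuclideanSpace ℝ (Fin d₂) :=
  G.bracketCLM ((∫ s in (0 : ℝ)..1, ω.base s) - (ω.1 1).1) v

theorem endpointArea_eq (v : EuclideanSpace ℝ (Fin d₁)) (ω : CarnotPath d₁ d₂) :
    ((G.shift v ω).1 1).2 - (ω.1 1).2 - (1 / 2 : ℝ) • G.bracket (ω.1 1).1 ((G.shift v ω).1 1).1
      = G.endpointArea v ω := by
  rw [← bracketCLM_apply, shift_apply, shiftPoint, endpointArea]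
  simp only [Set.Icc.coe_one, map_add, map_sub, sub_apply, one_smul,
    bracketCLM_self]
  module

theorem endpointArea_smul (c : ℝ) (v : EuclideanSpace ℝ (Fin d₁)) (ω : CarnotPath d₁ d₂) :
    G.endpointArea (c • v) ω = c • G.endpointArea v ω := by
  simp [endpointArea]

theorem endpointArea_shift (v u : EuclideanSpace ℝ (Fin d₁)) (ω : CarnotPath d₁ d₂) :
    G.endpointArea v (G.shift u ω) = G.endpointArea v ω - (1 / 2 : ℝ) • G.bracketCLM u v := by
  have h := G.integral_base_shift u ω 1
  simp only [Set.Icc.coe_one] at h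
  rw [endpointArea, endpointArea, h, shift_apply, shiftPoint]
  simp only [Set.Icc.coe_one, map_add, map_sub, map_smul, sub_apply,
    add_apply, smul_apply]
  module

/-- The lift of an absolutely continuous path, as an element of the path space. -/
noncomputable def liftPath {x : ℝ → EuclideanSpace ℝ (Fin d₁)} (hx : IsACZero x) :
    CarnotPath d₁ d₂ :=
  ⟨⟨G.lift x, by
    have hc : ContinuousOn x (Icc 0 1) := by
      simpa [uIcc_of_le zero_le_one] using hx.1.continuousOn
    have h1 : Continuous fun t : I => x t := hc.domRestrict
    have hI := G.intervalIntegrable_bracket_deriv hx.1.continuousOn hx.1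
    have h2 := (intervalIntegral.continuousOn_primitive_interval
      ((intervalIntegrable_iff' (by simp)).1 hI))
    rw [uIcc_of_le zero_le_one] at h2
    have h3 : Continuous fun t : I => ∫ s in (0 : ℝ)..t, G.bracket (x s) (deriv x s) :=
      h2.domRestrict
    exact h1.prodMk (h3.const_smul (1 / 2 : ℝ))⟩, by
    change G.lift x 0 = 0
    simp [lift, hx.2]⟩

theorem liftPath_apply {x : ℝ → EuclideanSpace ℝ (Fin d₁)} (hx : IsACZero x) (t : I) :
    (G.liftPath hx).1 t = G.lift x t := rfl

/-- On lifts of absolutely continuous paths the explicit formula for `T_h` agrees with `Ψ(x + h)`: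
integrate `s [v, x'_s]` by parts. -/
theorem lift_add_line {x : ℝ → EuclideanSpace ℝ (Fin d₁)} (hx : IsACZero x)
    (v : EuclideanSpace ℝ (Fin d₁)) (t : I) :
    G.lift (x + fun s : ℝ => s • v) t = (G.shift v (G.liftPath hx)).1 t := by
  have hsub : uIcc (0 : ℝ) t ⊆ uIcc 0 1 := by
    rw [uIcc_of_le t.2.1, uIcc_of_le zero_le_one]
    exact Icc_subset_Icc_right t.2.2
  have hac := hx.1.mono hsub
  have hxc : ContinuousOn x (uIcc 0 (t : ℝ)) := hac.continuousOn
  have hbase : ∫ s in (0 : ℝ)..t, (G.liftPath hx).base s = ∫ s in (0 : ℝ)..t, x s := by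
    refine intervalIntegral.integral_congr fun s hs => ?_
    have hs' : s ∈ Icc (0 : ℝ) 1 := by
      have := hsub hs
      rwa [uIcc_of_le zero_le_one] at this
    simp only [CarnotPath.base_of_mem _ hs']
    rfl
  refine Prod.ext rfl ?_
  rw [shift_apply, shiftPoint, hbase, liftPath_apply]
  simp only [lift, ← bracketCLM_apply]
  have hI1 := G.intervalIntegrable_bracket_deriv hxc hac
  simp only [← bracketCLM_apply] at hI1
  have hxi : IntervalIntegrable x volume 0 t := hxc.intervalIntegrable
  have hdi := hac.intervalIntegrable_deriv_euclidean
  have hI2 : IntervalIntegrable (fun s => G.bracketCLM (x s) v) volume 0 t :=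
    ((G.bracketCLM.flip v).continuous.comp_continuousOn hxc).intervalIntegrable
  have hsd : IntervalIntegrable (fun s : ℝ => s • deriv x s) volume 0 t :=
    hdi.continuousOn_smul continuousOn_id
  have hI3 : IntervalIntegrable (fun s => G.bracketCLM v (s • deriv x s)) volume 0 t :=
    ⟨(G.bracketCLM v).integrable_comp hsd.1, (G.bracketCLM v).integrable_comp hsd.2⟩
  have hibp : ∫ s in (0 : ℝ)..t, s • deriv x s = (t : ℝ) • x t - ∫ s in (0 : ℝ)..t, x s := by
    have hid : AbsolutelyContinuousOnInterval (fun s : ℝ => s) 0 (t : ℝ) :=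
      (LipschitzWith.id.lipschitzOnWith).absolutelyContinuousOnInterval
    have hm : AbsolutelyContinuousOnInterval (fun s : ℝ => s • x s) 0 (t : ℝ) := hid.smul hac
    have hftc := hm.integral_deriv_eq_sub_euclidean
    rw [zero_smul, sub_zero] at hftc
    rw [← hftc, ← intervalIntegral.integral_sub hm.intervalIntegrable_deriv_euclidean hxi]
    refine intervalIntegral.integral_congr_ae ?_
    filter_upwards [hac.boundedVariationOn.ae_differentiableAt_of_mem_uIcc] with s hs hsm
    have hd := ((hasDerivAt_id s).smul (hs (uIoc_subset_uIcc hsm)).hasDerivAt).deriv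
    have hd' : deriv (fun s : ℝ => s • x s) s = s • deriv x s + (1 : ℝ) • x s := hd
    rw [hd', one_smul, add_sub_cancel_right]
  -- the remaining term `[s v, v]` vanishes
  have hmain : ∫ s in (0 : ℝ)..t, G.bracketCLM (x s + s • v)
      (deriv (x + fun r : ℝ => r • v) s) = (∫ s in (0 : ℝ)..t, G.bracketCLM (x s) (deriv x s))
        + (∫ s in (0 : ℝ)..t, G.bracketCLM (x s) v)
        + ∫ s in (0 : ℝ)..t, G.bracketCLM v (s • deriv x s) := by
    rw [← intervalIntegral.integral_add hI1 hI2, ← intervalIntegral.integral_add (hI1.add hI2) hI3]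
    refine intervalIntegral.integral_congr_ae ?_
    filter_upwards [hac.boundedVariationOn.ae_differentiableAt_of_mem_uIcc] with s hs hsm
    have hline : HasDerivAt (fun s : ℝ => s • v) v s := by
      simpa using (hasDerivAt_id s).smul_const v
    rw [((hs (uIoc_subset_uIcc hsm)).hasDerivAt.add hline).deriv]
    simp only [map_add, map_smul, add_apply, smul_apply, bracketCLM_self]
    module
  have e2 : ∫ s in (0 : ℝ)..t, G.bracketCLM (x s) v = G.bracketCLM (∫ s in (0 : ℝ)..t, x s) v :=
    (G.bracketCLM.flip v).intervalIntegral_comp_comm hxi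
  have e3 : ∫ s in (0 : ℝ)..t, G.bracketCLM v (s • deriv x s)
      = G.bracketCLM v (∫ s in (0 : ℝ)..t, s • deriv x s) :=
    (G.bracketCLM v).intervalIntegral_comp_comm hsd
  simp only [Pi.add_apply]
  rw [hmain, e2, e3, hibp, map_sub, map_smul, G.bracketCLM_swap v, G.bracketCLM_swap v]
  module

theorem isShift_line (v : EuclideanSpace ℝ (Fin d₁)) (ω : CarnotPath d₁ d₂) :
    G.IsShift (fun s : ℝ => s • v) ω (G.shift v ω) := by
  intro x hx hlim
  have h1 : Tendsto (fun n => G.liftPath (hx n)) atTop (𝓝 ω) := by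
    rw [tendsto_subtype_rng, ContinuousMap.tendsto_iff_tendstoUniformly]
    exact hlim
  have h2 := ((G.continuous_shift v).tendsto ω).comp h1
  rw [tendsto_subtype_rng, ContinuousMap.tendsto_iff_tendstoUniformly] at h2
  have h3 : (fun n (t : I) => G.lift (x n + fun s : ℝ => s • v) t)
      = fun n t => (G.shift v (G.liftPath (hx n))).1 t := by
    funext n t
    exact G.lift_add_line (hx n) v t
  rw [h3]
  exact h2

theorem costCM_shift_le (v : EuclideanSpace ℝ (Fin d₁)) (ω : CarnotPath d₁ d₂) :
    G.costCM ω (G.shift v ω) ≤ ENNReal.ofReal ‖v‖ := by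
  have hd : deriv (fun s : ℝ => s • v) = fun _ => v := by
    ext1 s
    simpa using ((hasDerivAt_id s).smul_const v).deriv
  have hac : AbsolutelyContinuousOnInterval (fun s : ℝ => s • v) 0 1 :=
    ContDiffOn.absolutelyContinuousOnInterval (by fun_prop)
  have hcm : IsCameronMartin fun s : ℝ => s • v := by
    refine ⟨⟨hac, zero_smul _ _⟩, ?_⟩
    rw [hd]
    exact memLp_const v
  refine (iInf₂_le (fun s : ℝ => s • v) ⟨hcm, G.isShift_line v ω⟩).trans ?_
  unfold cameronMartinNorm
  rw [hd]
  refine (eLpNorm_le_of_ae_bound (C := ‖v‖) (by simp)).trans ?_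
  simp

end StepTwoCarnot

/-! ### Riemann sums and discrete areas -/

/-- The `k`-th point of the partition of `[0, q]` into `n + 1` intervals of equal length, for
`k ≤ n + 1`. -/
noncomputable def partitionPoint (q : I) (n k : ℕ) : I :=
  projIcc 0 1 zero_le_one ((q : ℝ) * (k / (n + 1)))

theorem partitionPoint_coe (q : I) {n k : ℕ} (hk : k ≤ n + 1) :
    (partitionPoint q n k : ℝ) = q * (k / (n + 1)) := by
  have h1 : (k : ℝ) / (n + 1) ≤ 1 := by
    rw [div_le_one (by positivity)]
    exact_mod_cast hk
  have h2 : (0 : ℝ) ≤ k / (n + 1) := by positivity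
  have hm : (q : ℝ) * (k / (n + 1)) ∈ Icc (0 : ℝ) 1 :=
    ⟨mul_nonneg q.2.1 h2, mul_le_one₀ q.2.2 h2 h1⟩
  rw [partitionPoint, projIcc_of_mem _ hm]

theorem partitionPoint_zero (q : I) (n : ℕ) : partitionPoint q n 0 = 0 :=
  Subtype.ext (by rw [partitionPoint_coe q (Nat.zero_le _)]; simp)

theorem partitionPoint_last (q : I) (n : ℕ) : partitionPoint q n (n + 1) = q :=
  Subtype.ext (by
    rw [partitionPoint_coe q le_rfl]
    push_cast
    rw [div_self (by positivity), mul_one])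

theorem monotone_partitionPoint (q : I) (n : ℕ) : Monotone (partitionPoint q n) := by
  intro j k hjk
  refine monotone_projIcc _ (mul_le_mul_of_nonneg_left ?_ q.2.1)
  gcongr

theorem partitionPoint_succ_sub (q : I) {n k : ℕ} (hk : k < n + 1) :
    (partitionPoint q n (k + 1) : ℝ) - partitionPoint q n k = q / (n + 1) := by
  rw [partitionPoint_coe q hk, partitionPoint_coe q hk.le]
  push_cast
  ring

theorem eventually_partitionPoint_mesh_lt (q : I) {ε : ℝ} (hε : 0 < ε) :
    ∀ᶠ n in atTop, ∀ k < n + 1, (partitionPoint q n (k + 1) : ℝ) - partitionPoint q n k < ε := by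
  have h := tendsto_one_div_add_atTop_nhds_zero_nat (𝕜 := ℝ)
  filter_upwards [h.eventually_lt_const hε] with n hn k hk
  rw [partitionPoint_succ_sub q hk]
  refine lt_of_le_of_lt ?_ hn
  gcongr
  exact q.2.2

/-- Riemann sums of a continuous function with arbitrary tags converge to its integral. -/
theorem tendsto_riemannSum {E : Type*} [NormedAddCommGroup E] [NormedSpace ℝ E] [CompleteSpace E]
    {f : ℝ → E} (hf : Continuous f) (q : I) {ξ : ℕ → ℕ → ℝ}
    (hξ : ∀ n, ∀ k < n + 1,
      ξ n k ∈ Icc (partitionPoint q n k : ℝ) (partitionPoint q n (k + 1))) :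
    Tendsto (fun n => ∑ k ∈ Finset.range (n + 1),
      ((partitionPoint q n (k + 1) : ℝ) - partitionPoint q n k) • f (ξ n k)) atTop
      (𝓝 (∫ s in (0 : ℝ)..q, f s)) := by
  have hu := (isCompact_Icc (a := (0 : ℝ)) (b := 1)).uniformContinuousOn_of_continuous
    hf.continuousOn
  rw [Metric.uniformContinuousOn_iff] at hu
  rw [Metric.tendsto_atTop']
  intro ε hε
  obtain ⟨δ, hδ, hfδ⟩ := hu (ε / 2) (by positivity)
  obtain ⟨N, hN⟩ := eventually_atTop.1 (eventually_partitionPoint_mesh_lt q hδ)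
  refine ⟨N, fun n hn => ?_⟩
  have hmono : ∀ k, (partitionPoint q n k : ℝ) ≤ partitionPoint q n (k + 1) := fun k =>
    monotone_partitionPoint q n (Nat.le_succ k)
  have hsplit : ∫ s in (0 : ℝ)..q, f s = ∑ k ∈ Finset.range (n + 1),
      ∫ s in (partitionPoint q n k : ℝ)..partitionPoint q n (k + 1), f s := by
    rw [intervalIntegral.sum_integral_adjacent_intervals
      (a := fun k => (partitionPoint q n k : ℝ)) fun k _ => hf.intervalIntegrable _ _,
      partitionPoint_zero, partitionPoint_last]
    rfl
  have hpiece : ∀ k ∈ Finset.range (n + 1),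
      ‖((partitionPoint q n (k + 1) : ℝ) - partitionPoint q n k) • f (ξ n k)
        - ∫ s in (partitionPoint q n k : ℝ)..partitionPoint q n (k + 1), f s‖
      ≤ ε / 2 * ((partitionPoint q n (k + 1) : ℝ) - partitionPoint q n k) := fun k hk => by
    have hk' := Finset.mem_range.1 hk
    rw [← intervalIntegral.integral_const, ← intervalIntegral.integral_sub
      (by simp) (hf.intervalIntegrable _ _)]
    refine (intervalIntegral.norm_integral_le_of_norm_le_const (C := ε / 2) fun s hs => ?_).trans
      (le_of_eq ?_)
    · rw [uIoc_of_le (hmono k)] at hs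
      have h0 := (partitionPoint q n k).2.1
      have h1 := (partitionPoint q n (k + 1)).2.2
      have hξk := hξ n k hk'
      have hmesh := hN n hn.le k hk'
      rw [← dist_eq_norm]
      refine (hfδ _ ⟨h0.trans hξk.1, hξk.2.trans h1⟩ _ ⟨h0.trans hs.1.le, hs.2.trans h1⟩ ?_).le
      rw [Real.dist_eq, abs_lt]
      constructor <;> linarith [hξk.1, hξk.2, hs.1, hs.2]
    · rw [abs_of_nonneg (sub_nonneg.2 (hmono k))]
  rw [dist_eq_norm, hsplit, ← Finset.sum_sub_distrib]
  refine lt_of_le_of_lt (norm_sum_le_of_le _ hpiece) ?_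
  rw [← Finset.mul_sum, Finset.sum_range_sub (fun k => (partitionPoint q n k : ℝ)),
    partitionPoint_last, partitionPoint_zero]
  have := q.2.2
  have h0 : ((0 : I) : ℝ) = 0 := rfl
  rw [h0]
  nlinarith

namespace StepTwoCarnot

variable {d₁ d₂ : ℕ} (G : StepTwoCarnot d₁ d₂)

/-- The left-endpoint approximation of the area `½ ∫_0^q [w_s, dw_s]` of a path `w`. -/
noncomputable def areaSum (w : I → EuclideanSpace ℝ (Fin d₁)) (q : I) (n : ℕ) :
    EuclideanSpace ℝ (Fin d₂) :=
  (1 / 2 : ℝ) • ∑ k ∈ Finset.range (n + 1), G.bracketCLM (w (partitionPoint q n k))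
    (w (partitionPoint q n (k + 1)) - w (partitionPoint q n k))

theorem areaSum_add_line (w : I → EuclideanSpace ℝ (Fin d₁)) (u : EuclideanSpace ℝ (Fin d₁)) (q : I)
    (n : ℕ) (hw : w 0 = 0) :
    G.areaSum (fun t => w t + (t : ℝ) • u) q n - G.areaSum w q n =
      (1 / 2 : ℝ) • (G.bracketCLM (∑ k ∈ Finset.range (n + 1),
          ((partitionPoint q n (k + 1) : ℝ) - partitionPoint q n k) • w (partitionPoint q n k)) u
        + G.bracketCLM u ((q : ℝ) • w q - ∑ k ∈ Finset.range (n + 1),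
          ((partitionPoint q n (k + 1) : ℝ) - partitionPoint q n k) •
            w (partitionPoint q n (k + 1)))) := by
  -- summation by parts
  have hparts : (q : ℝ) • w q = ∑ k ∈ Finset.range (n + 1),
      ((partitionPoint q n (k + 1) : ℝ) • w (partitionPoint q n (k + 1))
        - (partitionPoint q n k : ℝ) • w (partitionPoint q n k)) := by
    rw [Finset.sum_range_sub (fun k => (partitionPoint q n k : ℝ) • w (partitionPoint q n k)),
      partitionPoint_last, partitionPoint_zero, hw, smul_zero, sub_zero]
  rw [hparts, areaSum, areaSum, ← smul_sub, ← Finset.sum_sub_distrib, ← Finset.sum_sub_distrib,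
    map_sum, map_sum, sum_apply, ← Finset.sum_add_distrib]
  refine congrArg _ (Finset.sum_congr rfl fun k _ => ?_)
  simp only [map_add, map_sub, map_smul, add_apply, smul_apply, bracketCLM_self]
  module

/-- The second layer of the translate of a path is the limit of the corresponding change of the
discrete areas, whether or not the discrete areas themselves converge. -/
theorem tendsto_areaSum_shift_sub (u : EuclideanSpace ℝ (Fin d₁)) (ω : CarnotPath d₁ d₂) (q : I) :
    Tendsto (fun n => G.areaSum (fun t => ((G.shift u ω).1 t).1) q n
      - G.areaSum (fun t => (ω.1 t).1) q n) atTop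
      (𝓝 (((G.shift u ω).1 q).2 - (ω.1 q).2)) := by
  have hl := tendsto_riemannSum ω.continuous_base q (ξ := fun n k => partitionPoint q n k)
    fun n k _ => ⟨le_rfl, monotone_partitionPoint q n (Nat.le_succ k)⟩
  have hr := tendsto_riemannSum ω.continuous_base q (ξ := fun n k => partitionPoint q n (k + 1))
    fun n k _ => ⟨monotone_partitionPoint q n (Nat.le_succ k), le_rfl⟩
  simp only [CarnotPath.base_coe] at hl hr
  have hlim := ((((G.bracketCLM.flip u).continuous.tendsto _).comp hl).add
    (((G.bracketCLM u).continuous.tendsto _).comp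
      (hr.const_sub ((q : ℝ) • (ω.1 q).1)))).const_smul (1 / 2 : ℝ)
  have hval : ((G.shift u ω).1 q).2 - (ω.1 q).2 = (1 / 2 : ℝ) •
      (G.bracketCLM.flip u (∫ s in (0 : ℝ)..q, ω.base s)
        + G.bracketCLM u ((q : ℝ) • (ω.1 q).1 - ∫ s in (0 : ℝ)..q, ω.base s)) := by
    rw [shift_apply, shiftPoint, ContinuousLinearMap.flip_apply, map_sub, map_smul,
      G.bracketCLM_swap u, G.bracketCLM_swap u]
    module
  rw [hval]
  refine hlim.congr fun n => ?_
  have h0 : (ω.1 0).1 = 0 := by rw [ω.2]; rfl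
  exact (G.areaSum_add_line (fun t => (ω.1 t).1) u q n h0).symm

end StepTwoCarnot

/-! ### The Brownian bridge in one direction -/

namespace IsBrownianMotion

open scoped RealInnerProductSpace

variable {d : ℕ} {Ω : Type*} [MeasurableSpace Ω] {P : Measure Ω}
  {B : I → Ω → EuclideanSpace ℝ (Fin d)}

theorem hasLaw (hB : IsBrownianMotion B P) (t : I) :
    HasLaw (B t) ((stdGaussian (EuclideanSpace ℝ (Fin d))).map fun z => √(t : ℝ) • z) P := by
  have h := hB.law 0 t t.2.1
  simp only [Set.Icc.coe_zero, sub_zero] at h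
  refine h.congr ?_
  filter_upwards [hB.zero] with ω hω
  rw [hω, sub_zero]

theorem hasLaw_one (hB : IsBrownianMotion B P) :
    HasLaw (B 1) (stdGaussian (EuclideanSpace ℝ (Fin d))) P := by
  simpa using hB.hasLaw 1

theorem hasGaussianLaw (hB : IsBrownianMotion B P) (t : I) : HasGaussianLaw (B t) P := by
  constructor
  rw [(hB.hasLaw t).map_eq]
  exact isGaussian_map (μ := stdGaussian (EuclideanSpace ℝ (Fin d)))
    (√(t : ℝ) • ContinuousLinearMap.id ℝ _)

theorem isGaussianProcess (hB : IsBrownianMotion B P) : IsGaussianProcess B P :=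
  hB.indep.isGaussianProcess hB.hasGaussianLaw hB.zero

theorem memLp_inner (hB : IsBrownianMotion B P) (t : I) (x : EuclideanSpace ℝ (Fin d)) :
    MemLp (fun ω => ⟪x, B t ω⟫) 2 P :=
  ((hB.hasGaussianLaw t).map (innerSL ℝ x)).memLp_two

theorem covariance_self (hB : IsBrownianMotion B P) (t : I) (x y : EuclideanSpace ℝ (Fin d)) :
    cov[fun ω => ⟪x, B t ω⟫, fun ω => ⟪y, B t ω⟫; P] = (t : ℝ) * ⟪x, y⟫ := by
  rw [(hB.hasLaw t).covariance_fun_comp (f := fun z => ⟪x, z⟫) (g := fun z => ⟪y, z⟫)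
    (by fun_prop) (by fun_prop), covariance_map_fun (by fun_prop) (by fun_prop) (by fun_prop)]
  simp only [real_inner_smul_right]
  rw [covariance_const_mul_left, covariance_const_mul_right,
    ← covarianceBilin_apply_eq_cov IsGaussian.memLp_two_id, covarianceBilin_stdGaussian, ← mul_assoc,
    Real.mul_self_sqrt t.2.1]
  rfl

theorem covariance_one (hB : IsBrownianMotion B P) (t : I) (x y : EuclideanSpace ℝ (Fin d)) :
    cov[fun ω => ⟪x, B t ω⟫, fun ω => ⟪y, B 1 ω⟫; P] = (t : ℝ) * ⟪x, y⟫ := by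
  have hP : IsProbabilityMeasure P := hB.isGaussianProcess.isProbabilityMeasure
  have hind : IndepFun (B t) (B 1 - B t) P := hB.indep.indepFun_eval_sub t.2.1 t.2.2 hB.zero
  have hsplit : (fun ω => ⟪y, B 1 ω⟫) = (fun ω => ⟪y, B t ω⟫) + fun ω => ⟪y, (B 1 - B t) ω⟫ := by
    funext ω
    simp [inner_sub_right]
  have hm : MemLp (fun ω => ⟪y, (B 1 - B t) ω⟫) 2 P := by
    have := (hB.memLp_inner 1 y).sub (hB.memLp_inner t y)
    refine this.congr_norm ?_ (Eventually.of_forall fun ω => by simp [inner_sub_right])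
    refine this.1.congr (Eventually.of_forall fun ω => by simp [inner_sub_right])
  have h0 : cov[fun ω => ⟪x, B t ω⟫, fun ω => ⟪y, (B 1 - B t) ω⟫; P] = 0 :=
    IndepFun.covariance_eq_zero (hind.comp (φ := fun z => ⟪x, z⟫) (ψ := fun z => ⟪y, z⟫)
      (by fun_prop) (by fun_prop)) (hB.memLp_inner t x) hm
  rw [hsplit, covariance_add_right (hB.memLp_inner t x) (hB.memLp_inner t y) hm, h0,
    hB.covariance_self, add_zero]

/-- The bridge obtained from a Brownian motion by subtracting `t ⟨e, B₁⟩ e` for a unit vector `e` is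
independent of the final value of this component, since the two are jointly Gaussian and
uncorrelated. -/
theorem indepFun_bridge (hB : IsBrownianMotion B P) {e : EuclideanSpace ℝ (Fin d)} (he : ‖e‖ = 1) :
    IndepFun (fun ω (t : I) => B t ω - ((t : ℝ) * ⟪e, B 1 ω⟫) • e) (fun ω => ⟪e, B 1 ω⟫) P := by
  have hP : IsProbabilityMeasure P := hB.isGaussianProcess.isProbabilityMeasure
  set X : I → Ω → EuclideanSpace ℝ (Fin d) :=
    fun t ω => B t ω - ((t : ℝ) * ⟪e, B 1 ω⟫) • e with hXdef
  set Y : Unit → Ω → EuclideanSpace ℝ (Fin d) := fun _ ω => ⟪e, B 1 ω⟫ • e with hYdef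
  let L : EuclideanSpace ℝ (Fin d) →L[ℝ] EuclideanSpace ℝ (Fin d) := (innerSL ℝ e).smulRight e
  have hL : ∀ z, L z = ⟪e, z⟫ • e := fun z => rfl
  have hgauss : IsGaussianProcess (Sum.elim X Y) P := by
    refine hB.isGaussianProcess.of_isGaussianProcess fun s => ?_
    rcases s with t | u
    · let J : Finset I := {t, 1}
      refine ⟨J, ContinuousLinearMap.proj (R := ℝ) (φ := fun _ : J => EuclideanSpace ℝ (Fin d))
        ⟨t, by simp [J]⟩ - (t : ℝ) • L.comp (ContinuousLinearMap.proj (R := ℝ)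
        (φ := fun _ : J => EuclideanSpace ℝ (Fin d)) ⟨1, by simp [J]⟩), fun ω => ?_⟩
      simp [hXdef, hL, mul_smul]
    · let J : Finset I := {1}
      refine ⟨J, L.comp (ContinuousLinearMap.proj (R := ℝ)
        (φ := fun _ : J => EuclideanSpace ℝ (Fin d)) ⟨1, by simp [J]⟩), fun ω => ?_⟩
      simp [hYdef, hL]
  have hmX : ∀ t, AEMeasurable (X t) P := fun t => hgauss.aemeasurable (.inl t)
  have hmY : ∀ u, AEMeasurable (Y u) P := fun u => hgauss.aemeasurable (.inr u)
  have hind := hgauss.indepFun_of_covariance_inner hmX hmY fun t u x y => by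
    have e1 : (fun ω => ⟪x, X t ω⟫)
        = (fun ω => ⟪x, B t ω⟫) - fun ω => ((t : ℝ) * ⟪x, e⟫) * ⟪e, B 1 ω⟫ := by
      funext ω
      simp only [hXdef, inner_sub_right, real_inner_smul_right, Pi.sub_apply]
      ring
    have e2 : (fun ω => ⟪y, Y u ω⟫) = fun ω => ⟪y, e⟫ * ⟪e, B 1 ω⟫ := by
      funext ω
      simp only [hYdef, real_inner_smul_right]
      ring
    rw [e1, e2, covariance_const_mul_right, covariance_sub_left (hB.memLp_inner t x)
      ((hB.memLp_inner 1 e).const_mul _) (hB.memLp_inner 1 e), covariance_const_mul_left,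
      hB.covariance_one, hB.covariance_one, real_inner_self_eq_norm_sq, he]
    simp
  have hc := hind.comp (φ := id) (ψ := fun z : Unit → EuclideanSpace ℝ (Fin d) => ⟪e, z ()⟫)
    measurable_id (by fun_prop)
  refine hc.congr (EventuallyEq.rfl) (Eventually.of_forall fun ω => ?_)
  simp [hYdef, real_inner_smul_right, he]

theorem hasLaw_inner_one (hB : IsBrownianMotion B P) {e : EuclideanSpace ℝ (Fin d)}
    (he : ‖e‖ = 1) : HasLaw (fun ω => ⟪e, B 1 ω⟫) (gaussianReal 0 1) P := by
  have hg : HasGaussianLaw (fun ω => ⟪e, B 1 ω⟫) P :=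
    (hB.hasGaussianLaw 1).map (innerSL ℝ e)
  refine ⟨hg.aemeasurable, ?_⟩
  rw [hg.map_eq_gaussianReal, ← ProbabilityTheory.covariance_self hg.aemeasurable,
    hB.covariance_one, real_inner_self_eq_norm_sq, he]
  have hmean : ∫ ω, ⟪e, B 1 ω⟫ ∂P = 0 := by
    have h := hB.hasLaw_one.integral_comp (f := fun z => ⟪e, z⟫)
      (Continuous.aestronglyMeasurable (by fun_prop))
    exact h.trans (integral_strongDual_stdGaussian (innerSL ℝ e))
  rw [hmean]
  simp

end IsBrownianMotion

/-! ### Quasi-invariance of the law under translations along straight lines -/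

/-- A measurable map into the path space is independent of a random variable as soon as its values at
the times of a dense sequence are. -/
theorem CarnotPath.indepFun_of_dense {d₁ d₂ : ℕ} {Ω 𝓨 : Type*} [MeasurableSpace Ω]
    [MeasurableSpace 𝓨] {P : Measure Ω} {R : Ω → CarnotPath d₁ d₂} {Z : Ω → 𝓨} {q : ℕ → I}
    (hq : DenseRange q) (h : IndepFun (fun ω n => (R ω).1 (q n)) Z P) : IndepFun R Z P := by
  have hclosed : IsClosed {ω : C(I, CarnotPoint d₁ d₂) | ω 0 = 0} :=
    isClosed_eq (by fun_prop) continuous_const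
  have hpolish : PolishSpace (CarnotPath d₁ d₂) := hclosed.polishSpace
  let ι : CarnotPath d₁ d₂ → ℕ → CarnotPoint d₁ d₂ := fun ω n => ω.1 (q n)
  have hc : Continuous ι := by fun_prop
  have hinj : Function.Injective ι := fun ω ω' hω => by
    refine Subtype.ext (DFunLike.coe_injective ?_)
    exact hq.equalizer ω.1.continuous ω'.1.continuous hω
  have hme := hc.measurableEmbedding hinj
  rw [indepFun_iff_measure_inter_preimage_eq_mul] at h ⊢
  intro s t hs ht
  have hs' := h (ι '' s) t (hme.measurableSet_image.2 hs) ht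
  have hpre : (fun ω n => (R ω).1 (q n)) ⁻¹' (ι '' s) = R ⁻¹' s := by
    rw [show (fun ω n => (R ω).1 (q n)) = ι ∘ R from rfl, preimage_comp, hinj.preimage_image]
  rwa [hpre] at hs'

namespace IsCarnotBrownianMotion

open scoped RealInnerProductSpace

variable {d₁ d₂ : ℕ} {G : StepTwoCarnot d₁ d₂} {Ω : Type*} [MeasurableSpace Ω] {P : Measure Ω}
  {B : I → Ω → EuclideanSpace ℝ (Fin d₁)} {X : Ω → CarnotPath d₁ d₂}

theorem exists_seq_tendsto_itoSum (hX : IsCarnotBrownianMotion G P B X) (q : I) :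
    ∃ ns : ℕ → ℕ, StrictMono ns ∧ ∀ᵐ ω ∂P, Tendsto (fun i => ∑ k ∈ Finset.range (ns i + 1),
      G.horizontal ((X ω).1 (partitionPoint q (ns i) k))
        (B (partitionPoint q (ns i) (k + 1)) ω - B (partitionPoint q (ns i) k) ω)) atTop
      (𝓝 ((X ω).1 q)) :=
  (hX.sde q (fun n => n + 1) (fun n k => partitionPoint q n k) (monotone_partitionPoint q)
    (partitionPoint_zero q) (partitionPoint_last q)
    fun _ hε => eventually_partitionPoint_mesh_lt q hε).exists_seq_tendsto_ae

/-- The first layer of the Brownian motion on the group is the driving Brownian motion. -/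
theorem fst_ae_eq (hX : IsCarnotBrownianMotion G P B X) (q : I) :
    ∀ᵐ ω ∂P, ((X ω).1 q).1 = B q ω := by
  obtain ⟨ns, -, hns⟩ := hX.exists_seq_tendsto_itoSum q
  filter_upwards [hns, hX.brownian.zero] with ω hω h0
  have h1 := (continuous_fst.tendsto _).comp hω
  refine tendsto_nhds_unique h1 (tendsto_const_nhds.congr fun i => ?_)
  rw [Function.comp_apply, Prod.fst_sum]
  change B q ω = ∑ k ∈ Finset.range (ns i + 1),
    (B (partitionPoint q (ns i) (k + 1)) ω - B (partitionPoint q (ns i) k) ω)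
  rw [Finset.sum_range_sub (fun k => B (partitionPoint q (ns i) k) ω), partitionPoint_last,
    partitionPoint_zero, h0, sub_zero]

/-- The second layer is, along a subsequence, the limit of the discrete areas of the first. -/
theorem exists_seq_tendsto_areaSum (hX : IsCarnotBrownianMotion G P B X) (q : I) :
    ∃ ns : ℕ → ℕ, StrictMono ns ∧ ∀ᵐ ω ∂P,
      Tendsto (fun i => G.areaSum (fun t => ((X ω).1 t).1) q (ns i)) atTop
        (𝓝 ((X ω).1 q).2) := by
  obtain ⟨ns, hmono, hns⟩ := hX.exists_seq_tendsto_itoSum q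
  refine ⟨ns, hmono, ?_⟩
  have hall : ∀ᵐ ω ∂P, ∀ n k, ((X ω).1 (partitionPoint q n k)).1 = B (partitionPoint q n k) ω :=
    ae_all_iff.2 fun n => ae_all_iff.2 fun k => hX.fst_ae_eq _
  filter_upwards [hns, hall] with ω hω hB
  have h2 := (continuous_snd.tendsto _).comp hω
  refine h2.congr fun i => ?_
  rw [Function.comp_apply, Prod.snd_sum, StepTwoCarnot.areaSum, Finset.smul_sum]
  refine Finset.sum_congr rfl fun k _ => ?_
  rw [← hB, ← hB, StepTwoCarnot.bracketCLM_apply]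
  rfl

/-- The law of the Brownian motion on the group is quasi-invariant under translations along
straight lines: `X = T_{Z e} R`, where `Z` is a Gaussian variable independent of the path `R`. -/
theorem quasiMeasurePreserving_shift [IsProbabilityMeasure P] (hX : IsCarnotBrownianMotion G P B X)
    {μ : Measure (CarnotPath d₁ d₂)} (hμ : HasLaw X μ P) {e : EuclideanSpace ℝ (Fin d₁)}
    (he : ‖e‖ = 1) (c : ℝ) : Measure.QuasiMeasurePreserving (G.shift (c • e)) μ μ := by
  obtain ⟨X', hX'm, hXX'⟩ := hμ.aemeasurable
  have hfst : ∀ t, ∀ᵐ ω ∂P, B t ω = ((X' ω).1 t).1 := fun t => by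
    filter_upwards [hX.fst_ae_eq t, hXX'] with ω h1 h2
    rw [← h1, h2]
  have hev : ∀ t, Measurable fun ω => (X' ω).1 t := fun t =>
    (by fun_prop : Continuous fun ω : CarnotPath d₁ d₂ => ω.1 t).measurable.comp hX'm
  set Z : Ω → ℝ := fun ω => ⟪e, ((X' ω).1 1).1⟫ with hZ
  have hZm : Measurable Z := by
    have := (hev 1).fst
    fun_prop
  set R : Ω → CarnotPath d₁ d₂ := fun ω => G.shift (-Z ω • e) (X' ω) with hR
  have hRm : Measurable R := G.continuous_uncurry_shift.measurable.comp
    ((hZm.neg.smul_const e).prodMk hX'm)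
  have hXR : ∀ a ω, G.shift (a • e) (X' ω) = G.shift ((Z ω + a) • e) (R ω) := fun a ω => by
    rw [hR, G.shift_shift]
    congr 1
    module
  -- the first layer of `R` is the bridge, which is independent of `Z`
  let β : Ω → I → EuclideanSpace ℝ (Fin d₁) := fun ω t => ((R ω).1 t).1
  have hβm : Measurable β := measurable_pi_lambda _ fun t =>
    ((by fun_prop : Continuous fun ω : CarnotPath d₁ d₂ => (ω.1 t).1).measurable.comp hRm)
  have hZB : (fun ω => ⟪e, B 1 ω⟫) =ᵐ[P] Z := by
    filter_upwards [hfst 1] with ω hω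
    rw [hω]
  have hβZ : IndepFun β Z P := by
    have h1 := (hX.brownian.indepFun_bridge he).congr EventuallyEq.rfl hZB
    refine IndepFun.process_congr_left h1 fun t => ?_
    filter_upwards [hfst t, hfst 1] with ω ht h1
    rw [ht, h1]
    simp only [hR, StepTwoCarnot.shift_apply, StepTwoCarnot.shiftPoint, hZ]
    module
  -- the second layer of `R` is a measurable function of the bridge
  have hg : ∀ q, ∃ g : (I → EuclideanSpace ℝ (Fin d₁)) → EuclideanSpace ℝ (Fin d₂),
      Measurable g ∧ ∀ᵐ ω ∂P, g (β ω) = ((R ω).1 q).2 := fun q => by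
    obtain ⟨ns, hmono, hns⟩ := hX.exists_seq_tendsto_areaSum q
    have hlim : ∀ᵐ ω ∂P, Tendsto (fun i => G.areaSum (β ω) q (ns i)) atTop
        (𝓝 ((R ω).1 q).2) := by
      filter_upwards [hns, hXX'] with ω hω hω'
      rw [hω'] at hω
      have h2 := ((G.tendsto_areaSum_shift_sub (-Z ω • e) (X' ω) q).comp
        hmono.tendsto_atTop).add hω
      rw [sub_add_cancel] at h2
      exact h2.congr fun i => sub_add_cancel _ _
    have hsm : ∀ i, Measurable fun b : I → EuclideanSpace ℝ (Fin d₁) =>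
        G.areaSum b q (ns i) := fun i => by
      unfold StepTwoCarnot.areaSum
      refine Measurable.const_smul (Finset.measurable_sum _ fun k _ => ?_) (1 / 2 : ℝ)
      have hc := G.bracketCLM.continuous₂.measurable
      exact hc.comp (by fun_prop : Measurable fun b : I → EuclideanSpace ℝ (Fin d₁) =>
        (b (partitionPoint q (ns i) k),
          b (partitionPoint q (ns i) (k + 1)) - b (partitionPoint q (ns i) k)))
    obtain ⟨g, hgm, hgl⟩ := measurable_limit_of_tendsto_metrizable_ae (μ := P.map β) (L := atTop)
      (fun i => (hsm i).aemeasurable) (by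
        refine (ae_map_iff hβm.aemeasurable ?_).2 (hlim.mono fun ω hω => ⟨_, hω⟩)
        exact measurableSet_exists_tendsto hsm)
    refine ⟨g, hgm, ?_⟩
    filter_upwards [hlim, ae_of_ae_map hβm.aemeasurable hgl] with ω h1 h2
    exact tendsto_nhds_unique h2 h1
  choose g hgm hgR using hg
  have hRZ : IndepFun R Z P := by
    refine CarnotPath.indepFun_of_dense (TopologicalSpace.denseRange_denseSeq I) ?_
    have h1 := hβZ.comp (φ := fun b n => (b (TopologicalSpace.denseSeq I n),
      g (TopologicalSpace.denseSeq I n) b)) (ψ := id)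
      (measurable_pi_lambda _ fun n => (measurable_pi_apply _).prodMk (hgm _)) measurable_id
    refine IndepFun.process_congr_left (X := fun n ω => (β ω (TopologicalSpace.denseSeq I n),
      g (TopologicalSpace.denseSeq I n) (β ω))) h1 fun n => ?_
    filter_upwards [hgR (TopologicalSpace.denseSeq I n)] with ω hω
    rw [hω]
  -- the law of `(R, Z)` is a product, whose Gaussian factor is quasi-invariant
  have hZlaw : P.map Z = gaussianReal 0 1 := by
    rw [← Measure.map_congr hZB, (hX.brownian.hasLaw_inner_one he).map_eq]
  have hprod : P.map (fun ω => (R ω, Z ω)) = (P.map R).prod (gaussianReal 0 1) := by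
    rw [(indepFun_iff_map_prod_eq_prod_map_map hRm.aemeasurable hZm.aemeasurable).1 hRZ, hZlaw]
  have hX'law : P.map X' = μ := by rw [← hμ.map_eq, Measure.map_congr hXX']
  refine ⟨(G.continuous_shift _).measurable, Measure.AbsolutelyContinuous.mk fun A hA hA0 => ?_⟩
  have hcont : ∀ a : ℝ, Continuous fun p : CarnotPath d₁ d₂ × ℝ => G.shift ((p.2 + a) • e) p.1 :=
    fun a => G.continuous_uncurry_shift.comp (by fun_prop :
      Continuous fun p : CarnotPath d₁ d₂ × ℝ => ((p.2 + a) • e, p.1))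
  have hS : ∀ a : ℝ, MeasurableSet {p : CarnotPath d₁ d₂ × ℝ | G.shift ((p.2 + a) • e) p.1 ∈ A} :=
    fun a => (hcont a).measurable hA
  have hlaw : ∀ a : ℝ, μ (G.shift (a • e) ⁻¹' A) =
      (P.map R).prod (gaussianReal 0 1) {p | G.shift ((p.2 + a) • e) p.1 ∈ A} := fun a => by
    rw [← hprod, Measure.map_apply (hRm.prodMk hZm) (hS a), ← hX'law,
      Measure.map_apply hX'm ((G.continuous_shift _).measurable hA)]
    congr 1
    ext ω
    simp only [mem_preimage, mem_ofPred_eq, hXR]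
  have h0 : μ (G.shift ((0 : ℝ) • e) ⁻¹' A) = 0 := by
    rw [zero_smul, show G.shift (0 : EuclideanSpace ℝ (Fin d₁)) = id from
      funext G.shift_zero, preimage_id, hA0]
  rw [hlaw, Measure.measure_prod_null (hS 0)] at h0
  rw [Measure.map_apply (G.continuous_shift _).measurable hA, hlaw, Measure.measure_prod_null (hS c)]
  filter_upwards [h0] with r hr
  have hac : (gaussianReal 0 1).map (fun z => z + c) ≪ gaussianReal 0 1 := by
    rw [gaussianReal_map_add_const]
    exact (gaussianReal_absolutelyContinuous _ one_ne_zero).trans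
      (gaussianReal_absolutelyContinuous' _ one_ne_zero)
  have hr' := hac hr
  rw [Measure.map_apply (by fun_prop) (measurable_prodMk_left (hS 0))] at hr'
  simpa [preimage] using hr'

end IsCarnotBrownianMotion

/-! ### Non-existence of integrable contraction functions -/

namespace StepTwoCarnot

variable {d₁ d₂ : ℕ} (G : StepTwoCarnot d₁ d₂)

/-- If the Lipschitz bound holds along translations of `ω` by `v / (n + 1)` with a finite constant,
then the part of the displacement of the endpoint that is linear in `v` vanishes: a displacement of
order `1 / (n + 1)` in the second layer costs a distance of order `(n + 1)^(-1/2)`. -/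
theorem endpointArea_eq_zero_of_dcc_le {K : ℝ≥0∞} (hK : K ≠ ∞) {v : EuclideanSpace ℝ (Fin d₁)}
    {ω : CarnotPath d₁ d₂}
    (h : ∀ n : ℕ, G.dcc (ω.1 1) ((G.shift ((1 / ((n : ℝ) + 1)) • v) ω).1 1)
      ≤ K * G.costCM ω (G.shift ((1 / ((n : ℝ) + 1)) • v) ω)) :
    G.endpointArea v ω = 0 := by
  -- the summand `1` makes the inequality strict, also when `K` or `v` vanishes
  have hbound : ∀ n : ℕ, ‖G.endpointArea v ω‖
      ≤ ‖G.bracketCLM‖ * (K.toReal * ‖v‖ + 1) ^ 2 * (1 / ((n : ℝ) + 1)) := fun n => by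
    have hn : (0 : ℝ) < 1 / ((n : ℝ) + 1) := by positivity
    have hlt : G.dcc (ω.1 1) ((G.shift ((1 / ((n : ℝ) + 1)) • v) ω).1 1)
        < ENNReal.ofReal (1 / ((n : ℝ) + 1) * (K.toReal * ‖v‖ + 1)) := by
      refine (h n).trans_lt ?_
      calc _ ≤ K * ENNReal.ofReal ‖(1 / ((n : ℝ) + 1)) • v‖ := by
            gcongr
            exact G.costCM_shift_le _ _
        _ = ENNReal.ofReal (1 / ((n : ℝ) + 1) * (K.toReal * ‖v‖)) := by
            rw [norm_smul, Real.norm_of_nonneg hn.le, ← ENNReal.ofReal_toReal hK,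
              ← ENNReal.ofReal_mul ENNReal.toReal_nonneg, ENNReal.ofReal_toReal hK]
            congr 1
            ring
        _ < _ := by
            rw [ENNReal.ofReal_lt_ofReal_iff (by positivity)]
            exact mul_lt_mul_of_pos_left (lt_add_one _) hn
    have hd := G.norm_sub_le_of_dcc_lt (by positivity) hlt
    rw [endpointArea_eq, endpointArea_smul, norm_smul, Real.norm_of_nonneg hn.le] at hd
    refine le_of_mul_le_mul_left (hd.trans (le_of_eq ?_)) hn
    ring
  have hlim := (tendsto_one_div_add_atTop_nhds_zero_nat (𝕜 := ℝ)).const_mul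
    (‖G.bracketCLM‖ * (K.toReal * ‖v‖ + 1) ^ 2)
  rw [mul_zero] at hlim
  exact norm_le_zero_iff.1 (ge_of_tendsto' hlim hbound)

end StepTwoCarnot

namespace IsCarnotBrownianMotion

variable {d₁ d₂ : ℕ} {G : StepTwoCarnot d₁ d₂} {Ω : Type*} [MeasurableSpace Ω] {P : Measure Ω}
  [IsProbabilityMeasure P] {B : I → Ω → EuclideanSpace ℝ (Fin d₁)} {X : Ω → CarnotPath d₁ d₂}
  {μ : Measure (CarnotPath d₁ d₂)} {L : CarnotPath d₁ d₂ → ℝ≥0∞}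

theorem ae_endpointArea_eq_zero_of_ne_top (hX : IsCarnotBrownianMotion G P B X) (hμ : HasLaw X μ P)
    (hL : IsContractionFunction μ G.costCM G.dcc (fun ω => ω.1 1) L)
    {e : EuclideanSpace ℝ (Fin d₁)} (he : ‖e‖ = 1) :
    ∀ᵐ ω ∂μ, L ω ≠ ∞ → G.endpointArea e ω = 0 := by
  obtain ⟨-, E, hE, hLE⟩ := hL
  have hshift : ∀ᵐ ω ∂μ, ∀ n : ℕ, G.shift ((1 / ((n : ℝ) + 1)) • e) ω ∈ E :=
    ae_all_iff.2 fun n => (hX.quasiMeasurePreserving_shift hμ he _).ae hE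
  filter_upwards [hE, hshift] with ω hω hs hfin
  exact G.endpointArea_eq_zero_of_dcc_le hfin fun n => hLE _ hω _ (hs n)

/-- A contraction function is infinite with positive probability. Otherwise `endpointArea e` vanishes
almost surely, and so does its translate by `u`, which differs from it by `½ [u, e]`. -/
theorem measure_eq_top_pos (hX : IsCarnotBrownianMotion G P B X) (hμ : HasLaw X μ P)
    (hL : IsContractionFunction μ G.costCM G.dcc (fun ω => ω.1 1) L) :
    0 < μ {ω | L ω = ∞} := by
  have hμP : IsProbabilityMeasure μ := hμ.isProbabilityMeasure_iff.1 inferInstance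
  rw [pos_iff_ne_zero]
  intro h0
  have hfin : ∀ᵐ ω ∂μ, L ω ≠ ∞ := by
    rw [ae_iff]
    simpa using h0
  obtain ⟨i, j, hij⟩ := G.exists_bracket_basisFun_ne_zero
  have hnorm : ∀ k, ‖EuclideanSpace.basisFun (Fin d₁) ℝ k‖ = 1 :=
    (EuclideanSpace.basisFun (Fin d₁) ℝ).norm_eq_one
  have harea : ∀ᵐ ω ∂μ, G.endpointArea (EuclideanSpace.basisFun (Fin d₁) ℝ j) ω = 0 := by
    filter_upwards [hX.ae_endpointArea_eq_zero_of_ne_top hμ hL (hnorm j), hfin] with ω h1 h2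
    exact h1 h2
  have hshift := (hX.quasiMeasurePreserving_shift hμ (hnorm i) 1).ae harea
  obtain ⟨ω, h1, h2⟩ := (harea.and hshift).exists
  rw [one_smul, StepTwoCarnot.endpointArea_shift, h1, zero_sub, neg_eq_zero,
    smul_eq_zero_iff_right (by norm_num)] at h2
  exact hij (by rwa [StepTwoCarnot.bracketCLM_apply] at h2)

end IsCarnotBrownianMotion

theorem eLpNorm_eq_top_of_measure_eq_top_pos {α : Type*} [MeasurableSpace α] {μ : Measure α}
    {L : α → ℝ≥0∞} (hL : Measurable L) (h : 0 < μ {x | L x = ∞}) {q : ℝ≥0∞} (hq : 0 < q) :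
    eLpNorm L q μ = ∞ := by
  by_contra hne
  have hlt : eLpNorm L q μ < ∞ := lt_top_iff_ne_top.2 hne
  refine h.ne' ?_
  have hfin : ∀ᵐ x ∂μ, L x ≠ ∞ := by
    rcases eq_or_ne q ∞ with rfl | hqt
    · rw [eLpNorm_exponent_top] at hlt
      filter_upwards [ae_lt_of_essSup_lt hlt] with x hx
      exact hx.ne
    · have h1 := (eLpNorm_lt_top_iff_lintegral_rpow_enorm_lt_top hq.ne' hqt).1 hlt
      filter_upwards [ae_lt_top (by fun_prop) h1.ne] with x hx hx'
      rw [hx', enorm_eq_self, ENNReal.top_rpow_of_pos (ENNReal.toReal_pos hq.ne' hqt)] at hx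
      exact hx.ne rfl
  simpa [ae_iff] using hfin

theorem proposition5p8 {d₁ d₂ : ℕ} (G : StepTwoCarnot d₁ d₂)
    {Ω : Type*} [MeasurableSpace Ω] (P : Measure Ω) [IsProbabilityMeasure P]
    (B : I → Ω → EuclideanSpace ℝ (Fin d₁)) (X : Ω → CarnotPath d₁ d₂)
    (hX : IsCarnotBrownianMotion G P B X)
    (μ : Measure (CarnotPath d₁ d₂)) (hμ : HasLaw X μ P) :
    (∀ L : CarnotPath d₁ d₂ → ℝ≥0∞,
      IsContractionFunction μ G.costCM G.dcc (fun ω => ω.1 1) L →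
        0 < μ {ω | L ω = ∞} ∧ ∀ q : ℝ≥0∞, 0 < q → eLpNorm L q μ = ∞) ∧
    -- the contraction principle needs a contraction function in `L^q` with `q = 2p / (2 - p)`
    -- (`q = ∞` for `p = 2`) in order to pass from a `T_2` to a `T_p` inequality
    ∀ p : ℝ≥0∞, 1 ≤ p → p ≤ 2 →
      ¬ ∃ L : CarnotPath d₁ d₂ → ℝ≥0∞,
        IsContractionFunction μ G.costCM G.dcc (fun ω => ω.1 1) L ∧
          MemLp L (2 * p / (2 - p)) μ := by
  have hmain : ∀ L : CarnotPath d₁ d₂ → ℝ≥0∞,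
      IsContractionFunction μ G.costCM G.dcc (fun ω => ω.1 1) L →
        0 < μ {ω | L ω = ∞} ∧ ∀ q : ℝ≥0∞, 0 < q → eLpNorm L q μ = ∞ := fun L hL =>
    ⟨hX.measure_eq_top_pos hμ hL, fun q hq =>
      eLpNorm_eq_top_of_measure_eq_top_pos hL.1 (hX.measure_eq_top_pos hμ hL) hq⟩
  refine ⟨hmain, fun p hp _ => ?_⟩
  rintro ⟨L, hL, hLp⟩
  -- the exponent is positive, and equal to `∞` for `p = 2`, where the denominator vanishes
  have hq : 0 < 2 * p / (2 - p) :=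
    ENNReal.div_pos (mul_ne_zero two_ne_zero (zero_lt_one.trans_le hp).ne')
      (ENNReal.sub_ne_top ENNReal.ofNat_ne_top)
  exact hLp.2.ne ((hmain L hL).2 _ hq)
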